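/- Let $p$ be an odd prime. A $\mathbb{Z}_p$-Lie lattice is a Lie algebra over $\mathbb{Z}_p$ whose underlying $\mathbb{Z}_p$-module is free of finite rank; this rank is its dimension (likewise for a Lie ideal). It is residually nilpotent if $\bigcap_{k} \gamma_k(L) = 0$, where $\gamma_k(L)$ are the terms of the lower central series. A $\mathbb{Z}_p$-Lie lattice $L$ is saturable if there is a map $w : L \to \mathbb{R} \cup \{\infty\}$ such that for all $x, y \in L$ and all non-zero $c \in \mathbb{Z}_p$: $w(x) = \infty$ if and only if $x = 0$; $w(x) > \frac{1}{p-1}$; $w(x-y) \ge \min\{w(x), w(y)\}$; $w(cx) = v_p(c) + w(x)$; $w([x,y]) \ge w(x) + w(y)$; and $w(x) > \frac{p}{p-1}$ implies $x \in pL$. A Lie ideal $M$ of $L$ is PF-embedded in $L$ if there is a descending series $M = N_1 \supseteq N_2 \supseteq \cdots$ of Lie ideals of $L$ with $\bigcap_i N_i = 0$ such that for all $i \ge 1$ one has $[N_i, L] \subseteq N_{i+1}$ and $[N_i, L, \ldots, L] \subseteq p N_{i+1}$, where $L$ occurs $p-1$ times in the left-normed bracket. Theorem. (1) Every residually nilpotent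 $\mathbb{Z}_p$-Lie lattice of dimension less than $p$ is saturable. (2) If $L$ is a saturable $\mathbb{Z}_p$-Lie lattice and $M$ is a Lie ideal of $L$ of dimension less than $p$, then $M$ is PF-embedded in $L$. -/

import Mathlib

section LieLattices

variable (p : ℕ) [Fact p.Prime] (L : Type*) [LieRing L] [LieAlgebra ℤ_[p] L]

/-- A `ℤ_p`-Lie lattice: a Lie algebra over `ℤ_p` whose underlying module is free of finite rank.
Its dimension is `Module.finrank ℤ_[p] L`. -/
class IsLieLattice : Prop where
  free : Module.Free ℤ_[p] L
  finite : Module.Finite ℤ_[p] L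

/-- `L` is residually nilpotent: the terms of its lower central series intersect in zero. -/
def IsResiduallyNilpotent : Prop :=
  ⨅ k : ℕ, LieModule.lowerCentralSeries ℤ_[p] L L k = ⊥

/-- `w : L → ℝ ∪ {∞}` is a valuation of the Lie algebra `L` in the sense of Lazard, with values
larger than `1 / (p - 1)`. -/
structure IsLieValuation (w : L → WithTop ℝ) : Prop where
  eq_top_iff : ∀ x, w x = ⊤ ↔ x = 0
  gt : ∀ x, (((1 : ℝ) / ((p : ℝ) - 1) : ℝ) : WithTop ℝ) < w x
  min_le_sub : ∀ x y, min (w x) (w y) ≤ w (x - y)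
  smul : ∀ (c : ℤ_[p]) (x : L), c ≠ 0 → w (c • x) = (((c.valuation : ℕ) : ℝ) : WithTop ℝ) + w x
  add_le_lie : ∀ x y, w x + w y ≤ w ⁅x, y⁆

/-- `(L, w)` is saturated: `w` is a valuation and every `x` with `w x > p / (p - 1)` is divisible
by `p` in `L`. On a lattice, completeness for the topology defined by `w` is then automatic: that
topology is the `p`-adic one, because `p ^ k • L ⊆ {x | w x ≥ k}` and
`{x | w x > k + 1 / (p - 1)} ⊆ p ^ k • L`. -/
structure IsSaturated (w : L → WithTop ℝ) : Prop extends IsLieValuation p L w where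
  divisible : ∀ x, (((p : ℝ) / ((p : ℝ) - 1) : ℝ) : WithTop ℝ) < w x →
    ∃ y : L, (p : ℤ_[p]) • y = x

/-- `L` is saturable: it admits a valuation for which it is saturated. -/
def IsSaturable : Prop :=
  ∃ w : L → WithTop ℝ, IsSaturated p L w

variable {L}

/-- `N 0 ≥ N 1 ≥ ⋯` is a potent filtration of the Lie ideal `M` in `L`. Here `LieSubmodule.lcs k (N i)` is
`⁅L, ⁅L, …, ⁅L, N i⁆⁆⁆` with `L` occurring `k` times, the same ideal as `[N i, L, …, L]`. (Ideals
of a lattice, being submodules, are automatically closed in the `p`-adic topology.) -/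
structure IsPotentFiltration (M : LieIdeal ℤ_[p] L) (N : ℕ → LieIdeal ℤ_[p] L) : Prop where
  antitone : Antitone N
  zero_eq : N 0 = M
  iInf_eq : ⨅ i, N i = ⊥
  lie_le : ∀ i, ⁅(⊤ : LieIdeal ℤ_[p] L), N i⁆ ≤ N (i + 1)
  lcs_le : ∀ i, ∀ x ∈ LieSubmodule.lcs (p - 1) (N i), ∃ y ∈ N (i + 1), (p : ℤ_[p]) • y = x

/-- The Lie ideal `M` is PF-embedded in `L`: there is a potent filtration of `M` in `L`. -/
def IsPFEmbedded (M : LieIdeal ℤ_[p] L) : Prop :=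
  ∃ N : ℕ → LieIdeal ℤ_[p] L, IsPotentFiltration p M N

end LieLattices

/-!
Both parts rest on one dimension count. Let `M` be a `ℤ_p`-lattice with an action of `L` whose lower
central series has trivial intersection. By compactness some term of the series lies in `p M`, so
the lower central series of `M / p M` descends strictly until it reaches zero, which takes at most
`finrank M` steps (`lcs_le_smul_of_finrank_le`). For `M = L` one step is gained
(`lcs_le_smul_of_finrank_le_succ`), because a Lie algebra which is nilpotent and not abelian has an
abelianization of dimension at least two.

For the first part, let `q = p - 2`. The `q`-th term of the lower central series of `L` (counted
from `0`) lies in `p L`. Give the `k`-th term weight `k + 1` and let multiplication by `p` raise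
weights by `q`. In the resulting filtration (`weightedLCS`) a bracket has at least the sum of the weights,
and the inclusion above says precisely that `p` shifts the filtration by `q`. Dividing weights by
`q` yields a saturated valuation: its values are at least `1 / (p - 2) > 1 / (p - 1)`, and an
element of value larger than `1` is divisible by `p`.

For the second part, let `N ↦ [N, L] + p⁻¹ [N, L, …, L]` (`potentStep`, with `p - 1` factors `L`) and
iterate this from `M`. The count shows that the iterates stay inside `M`. If `w` is bounded
below by `c > 1 / (p - 1)`, each step raises `w` by at least `min c ((p - 1) c - 1) > 0`, so that the
intersection is zero.
-/

open LieModule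

/-! ### Submodules of lattices over the `p`-adic integers -/

/-- Chevalley's theorem for `ℤ_p`-lattices: a descending chain of submodules with trivial
intersection eventually lies in `p M`. Submodules of `M ≅ ℤ_p ^ d` are compact and `p M` is open, so
the sets `P k \ p M` cannot all be nonempty. -/
theorem exists_forall_mem_exists_smul_eq_of_iInf_eq_bot {p : ℕ} [Fact p.Prime] {M : Type*}
    [AddCommGroup M] [Module ℤ_[p] M] [Module.Free ℤ_[p] M] [Module.Finite ℤ_[p] M]
    {P : ℕ → Submodule ℤ_[p] M} (hP : Antitone P) (h : ⨅ k, P k = ⊥) :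
    ∃ k, ∀ x ∈ P k, ∃ y : M, (p : ℤ_[p]) • y = x := by
  by_contra! hcon
  let b := Module.Free.chooseBasis ℤ_[p] M
  let e := b.equivFun
  let U : Set (Module.Free.ChooseBasisIndex ℤ_[p] M → ℤ_[p]) := ⋂ i, {v | ‖v i‖ < 1}
  have hU : IsOpen U := isOpen_iInter_of_finite fun i =>
    isOpen_lt (continuous_norm.comp (continuous_apply i)) continuous_const
  have hUdiv : ∀ v ∈ U, ∃ y : M, (p : ℤ_[p]) • y = e.symm v := by
    intro v hv
    have : ∀ i, ∃ c : ℤ_[p], v i = p * c := fun i =>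
      (PadicInt.norm_lt_one_iff_dvd _).1 (Set.mem_iInter.1 hv i)
    choose c hc using this
    refine ⟨e.symm c, ?_⟩
    rw [← map_smul]
    congr 1
    ext1 i
    simp [hc]
  let K : ℕ → Set (Module.Free.ChooseBasisIndex ℤ_[p] M → ℤ_[p]) := fun k =>
    ((P k).map e.toLinearMap : Set _) \ U
  have hcpt : ∀ k, IsCompact (K k) := fun k =>
    (Submodule.isCompact_of_fg (IsNoetherian.noetherian _)).diff hU
  obtain ⟨v, hv⟩ := IsCompact.nonempty_iInter_of_sequence_nonempty_isCompact_isClosed K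
    (fun k => Set.sdiff_subset_sdiff_left (Submodule.map_mono (hP k.le_succ)))
    (fun k => by
      obtain ⟨x, hx, hxd⟩ := hcon k
      refine ⟨e x, Submodule.mem_map_of_mem hx, fun hxU => ?_⟩
      obtain ⟨y, hy⟩ := hUdiv _ hxU
      exact hxd y (by simpa using hy))
    (hcpt 0) (fun k => (hcpt k).isClosed)
  rw [Set.mem_iInter] at hv
  have hv0 : e.symm v ∈ ⨅ k, P k := by
    rw [Submodule.mem_iInf]
    intro k
    obtain ⟨x, hx, rfl⟩ := (hv k).1
    simpa using hx
  rw [h, Submodule.mem_bot] at hv0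
  refine (hv 0).2 ?_
  have : v = 0 := by simpa using hv0
  simp [U, this]

/-- A strictly descending chain of submodules of `M` which all contain `p M` has at most
`finrank M` steps, because `M / p M` has length `finrank M`. -/
theorem length_le_finrank_of_strict_chain {p : ℕ} [Fact p.Prime] {M : Type*} [AddCommGroup M]
    [Module ℤ_[p] M] [Module.Free ℤ_[p] M] [Module.Finite ℤ_[p] M] {C : ℕ → Submodule ℤ_[p] M}
    {n : ℕ} (hlt : ∀ i < n, C (i + 1) < C i) (hp : ∀ i ≤ n, ∀ y : M, (p : ℤ_[p]) • y ∈ C i) :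
    n ≤ Module.finrank ℤ_[p] M := by
  let b := Module.Free.chooseBasis ℤ_[p] M
  let κ := IsLocalRing.ResidueField ℤ_[p]
  -- Reduction of coordinates modulo `p`; its kernel is `p M`.
  let f : M →ₗ[ℤ_[p]] (Module.Free.ChooseBasisIndex ℤ_[p] M → κ) :=
    LinearMap.pi fun i => (Algebra.linearMap ℤ_[p] κ).comp (b.coord i)
  have hker : ∀ i ≤ n, LinearMap.ker f ≤ C i := by
    intro i hi x hx
    have : ∀ j, ∃ c : ℤ_[p], b.coord j x = p * c := fun j => by
      have h1 : IsLocalRing.residue ℤ_[p] (b.coord j x) = 0 := congrFun hx j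
      rw [IsLocalRing.residue_eq_zero_iff, PadicInt.maximalIdeal_eq_span_p,
        Ideal.mem_span_singleton] at h1
      exact h1
    choose c hc using this
    have hx' : x = (p : ℤ_[p]) • ∑ j, c j • b j := by
      rw [Finset.smul_sum, ← b.sum_equivFun x]
      refine Finset.sum_congr rfl fun j _ => ?_
      rw [smul_smul, ← hc j]
      rfl
    rw [hx']
    exact hp i hi _
  have hsimple : IsSimpleModule ℤ_[p] κ := by
    have : IsSimpleModule ℤ_[p] (ℤ_[p] ⧸ IsLocalRing.maximalIdeal ℤ_[p]) := by
      rw [isSimpleModule_iff_isCoatom, ← Ideal.isMaximal_def]; infer_instance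
    exact this
  have hlen : Module.length ℤ_[p] (Module.Free.ChooseBasisIndex ℤ_[p] M → κ) =
      Module.finrank ℤ_[p] M := by
    rw [Module.length_pi_of_fintype]
    simp [Module.length_eq_one, Module.finrank_eq_card_chooseBasisIndex]
  have hfl : IsFiniteLength ℤ_[p] (Module.Free.ChooseBasisIndex ℤ_[p] M → κ) := by
    rw [← Module.length_ne_top_iff, hlen]; simp
  obtain ⟨_, _⟩ := isFiniteLength_iff_isNoetherian_isArtinian.1 hfl
  have hmap : ∀ i < n, (C (i + 1)).map f < (C i).map f := by
    intro i hi
    refine lt_of_le_of_ne (Submodule.map_mono (hlt i hi).le) fun h => (hlt i hi).ne ?_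
    have := congrArg (Submodule.comap f) h
    rwa [Submodule.comap_map_eq, Submodule.comap_map_eq, sup_eq_left.2, sup_eq_left.2] at this
    · exact hker i hi.le
    · exact hker _ hi
  have hheight : ∀ i, ∀ j, i + j = n → (i : ℕ∞) ≤ Order.height ((C j).map f) := by
    intro i
    induction i with
    | zero => simp
    | succ i ih =>
      intro j hj
      have h1 := ih (j + 1) (by omega)
      have h2 := Submodule.height_strictMono (hmap j (by omega))
      push_cast
      exact Order.add_one_le_of_lt (h1.trans_lt h2)
  have h1 := hheight n 0 (by simp)
  rw [← Module.length_submodule] at h1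
  have h2 := h1.trans (Module.length_le_of_injective ((C 0).map f).subtype
    (Submodule.injective_subtype _))
  rw [hlen] at h2
  exact_mod_cast h2

/-! ### The lower central series modulo `p` -/

section
variable {p : ℕ} [Fact p.Prime] {L : Type*} [LieRing L] [LieAlgebra ℤ_[p] L]

/-- The preimage in `M` of the `k`-th term of the lower central series of `M / p M`. -/
noncomputable def lcsAddP (p : ℕ) [Fact p.Prime] (L M : Type*) [LieRing L] [LieAlgebra ℤ_[p] L]
    [AddCommGroup M] [Module ℤ_[p] M] [LieRingModule L M] [LieModule ℤ_[p] L M] (k : ℕ) :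
    Submodule ℤ_[p] M :=
  (lowerCentralSeries ℤ_[p] L M k : Submodule ℤ_[p] M) ⊔
    LinearMap.range (LinearMap.lsmul ℤ_[p] M (p : ℤ_[p]))

variable {M : Type*} [AddCommGroup M] [Module ℤ_[p] M] [LieRingModule L M] [LieModule ℤ_[p] L M]

theorem mem_lcsAddP {k : ℕ} {x : M} : x ∈ lcsAddP p L M k ↔
    ∃ y ∈ lowerCentralSeries ℤ_[p] L M k, ∃ z : M, y + (p : ℤ_[p]) • z = x := by
  simp [lcsAddP, Submodule.mem_sup]

theorem smul_mem_lcsAddP (k : ℕ) (y : M) : (p : ℤ_[p]) • y ∈ lcsAddP p L M k :=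
  mem_lcsAddP.2 ⟨0, zero_mem _, y, zero_add _⟩

theorem lcs_le_lcsAddP (k : ℕ) :
    (lowerCentralSeries ℤ_[p] L M k : Submodule ℤ_[p] M) ≤ lcsAddP p L M k := le_sup_left

theorem antitone_lcsAddP : Antitone (lcsAddP p L M) := fun k l h =>
  sup_le_sup_right (show (lowerCentralSeries ℤ_[p] L M l : Submodule ℤ_[p] M) ≤
    lowerCentralSeries ℤ_[p] L M k from antitone_lowerCentralSeries ℤ_[p] L M h) _

theorem lcsAddP_step {k l : ℕ} (h : lcsAddP p L M k ≤ lcsAddP p L M l) :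
    lcsAddP p L M (k + 1) ≤ lcsAddP p L M (l + 1) := by
  refine sup_le ?_ le_sup_right
  rw [lowerCentralSeries_succ, LieSubmodule.lieIdeal_oper_eq_linear_span', Submodule.span_le]
  rintro _ ⟨x, -, m, hm, rfl⟩
  obtain ⟨a, ha, b, rfl⟩ := mem_lcsAddP.1 (h (lcs_le_lcsAddP k hm))
  refine mem_lcsAddP.2 ⟨⁅x, a⁆, ?_, ⁅x, b⁆, by simp⟩
  rw [lowerCentralSeries_succ]
  exact LieSubmodule.lie_mem_lie (LieSubmodule.mem_top x) ha

/-- Once the lower central series of `M / p M` repeats a term, it is constant from there on. -/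
theorem lcsAddP_stationary {k : ℕ} (h : lcsAddP p L M k ≤ lcsAddP p L M (k + 1)) (j : ℕ) :
    lcsAddP p L M k ≤ lcsAddP p L M (k + j) := by
  have hstep : ∀ j, lcsAddP p L M (k + j) ≤ lcsAddP p L M (k + j + 1) := by
    intro j
    induction j with
    | zero => exact h
    | succ j ih => exact lcsAddP_step ih
  induction j with
  | zero => exact le_rfl
  | succ j ih => exact ih.trans (hstep j)

variable [Module.Free ℤ_[p] M] [Module.Finite ℤ_[p] M]

/-- A nonzero term of the lower central series of `M / p M` strictly contains the next one. -/
theorem lcsAddP_lt (h : ⨅ k, lowerCentralSeries ℤ_[p] L M k = ⊥) {k : ℕ} {x : M}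
    (hx : x ∈ lcsAddP p L M k) (hxp : ¬ ∃ y, (p : ℤ_[p]) • y = x) :
    lcsAddP p L M (k + 1) < lcsAddP p L M k := by
  refine (antitone_lcsAddP k.le_succ).lt_of_not_ge fun hle => hxp ?_
  obtain ⟨l, hl⟩ := exists_forall_mem_exists_smul_eq_of_iInf_eq_bot
    (P := fun k => (lowerCentralSeries ℤ_[p] L M k : Submodule ℤ_[p] M))
    (fun _ _ h => antitone_lowerCentralSeries ℤ_[p] L M h)
    (by rw [← LieSubmodule.iInf_toSubmodule, h, LieSubmodule.bot_toSubmodule])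
  obtain ⟨a, ha, b, rfl⟩ := mem_lcsAddP.1 (lcsAddP_stationary hle l hx)
  obtain ⟨c, rfl⟩ := hl a (antitone_lowerCentralSeries ℤ_[p] L M (Nat.le_add_left l k) ha)
  exact ⟨c + b, smul_add _ _ _⟩

/-- The lower central series of `M / p M` descends strictly until it vanishes, hence vanishes after
at most `finrank M` steps. -/
theorem lcs_le_smul_of_finrank_le (h : ⨅ k, lowerCentralSeries ℤ_[p] L M k = ⊥) {m : ℕ}
    (hm : Module.finrank ℤ_[p] M ≤ m) :
    ∀ x ∈ lowerCentralSeries ℤ_[p] L M m, ∃ y : M, (p : ℤ_[p]) • y = x := by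
  intro x hx
  by_contra hxp
  have := length_le_finrank_of_strict_chain (C := lcsAddP p L M) (n := m + 1)
    (fun i hi => lcsAddP_lt h
      (antitone_lcsAddP (Nat.lt_succ_iff.1 hi) (lcs_le_lcsAddP m hx)) hxp)
    (fun i _ y => smul_mem_lcsAddP i y)
  omega

end

section
variable {p : ℕ} [Fact p.Prime] {L : Type*} [LieRing L] [LieAlgebra ℤ_[p] L]

/-- If the abelianization of `L / p L` is cyclic, then the lower central series of `L / p L` is
stationary from its second term on. -/
theorem lcsAddP_one_le_two_of_cyclic {x : L}
    (hx : Submodule.span ℤ_[p] {x} ⊔ lcsAddP p L L 1 = ⊤) :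
    lcsAddP p L L 1 ≤ lcsAddP p L L 2 := by
  have hdec : ∀ y : L, ∃ c : ℤ_[p], ∃ a ∈ lowerCentralSeries ℤ_[p] L L 1, ∃ b : L,
      y = c • x + a + (p : ℤ_[p]) • b := by
    intro y
    have hy : y ∈ Submodule.span ℤ_[p] {x} ⊔ lcsAddP p L L 1 := hx ▸ Submodule.mem_top
    obtain ⟨u, hu, v, hv, rfl⟩ := Submodule.mem_sup.1 hy
    obtain ⟨c, rfl⟩ := Submodule.mem_span_singleton.1 hu
    obtain ⟨a, ha, b, rfl⟩ := mem_lcsAddP.1 hv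
    exact ⟨c, a, ha, b, by abel⟩
  have hlie : ∀ (u : L), ∀ a ∈ lowerCentralSeries ℤ_[p] L L 1,
      ⁅u, a⁆ ∈ lcsAddP p L L 2 := fun u a ha => lcs_le_lcsAddP 2 (by
    have := LieSubmodule.lie_mem_lie (LieSubmodule.mem_top (R := ℤ_[p]) u) ha
    rwa [← lowerCentralSeries_succ] at this)
  refine sup_le ?_ le_sup_right
  rw [lowerCentralSeries_succ, LieSubmodule.lieIdeal_oper_eq_linear_span', Submodule.span_le]
  rintro _ ⟨y, -, z, -, rfl⟩
  obtain ⟨c, a, ha, b, rfl⟩ := hdec y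
  obtain ⟨c', a', ha', b', rfl⟩ := hdec z
  have key : ⁅c • x + a + (p : ℤ_[p]) • b, c' • x + a' + (p : ℤ_[p]) • b'⁆ =
      ⁅c • x + a, a'⁆ - ⁅c' • x, a⁆ + (p : ℤ_[p]) • (⁅c • x + a, b'⁆ +
        ⁅b, c' • x + a' + (p : ℤ_[p]) • b'⁆) := by
    rw [← lie_skew (c' • x) a]
    simp only [lie_add, add_lie, lie_smul, smul_lie, lie_self, smul_add, smul_zero,
      smul_smul]
    simp only [mul_comm]
    abel
  rw [key]
  exact add_mem (sub_mem (hlie _ _ ha') (hlie _ _ ha)) (smul_mem_lcsAddP _ _)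

/-- For the adjoint module `lcs_le_smul_of_finrank_le` improves by one step: unless it is zero, the
derived algebra of `L / p L` has codimension at least two. -/
theorem lcs_le_smul_of_finrank_le_succ [Module.Free ℤ_[p] L] [Module.Finite ℤ_[p] L]
    (h : ⨅ k, lowerCentralSeries ℤ_[p] L L k = ⊥) {m : ℕ} (hm0 : 1 ≤ m)
    (hm : Module.finrank ℤ_[p] L ≤ m + 1) :
    ∀ x ∈ lowerCentralSeries ℤ_[p] L L m, ∃ y : L, (p : ℤ_[p]) • y = x := by
  intro x hx
  by_contra hxp
  have hlt : ∀ i ≤ m, lcsAddP p L L (i + 1) < lcsAddP p L L i := fun i hi =>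
    lcsAddP_lt h (antitone_lcsAddP hi (lcs_le_lcsAddP m hx)) hxp
  obtain ⟨z, -, hz⟩ := SetLike.exists_of_lt (hlt 0 (Nat.zero_le _))
  -- The series of `L / p L` with one more term inserted between the first two. The insertion is
  -- strict above, since a cyclic abelianization would make the series stationary.
  let C : ℕ → Submodule ℤ_[p] L
    | 0 => ⊤
    | 1 => Submodule.span ℤ_[p] {z} ⊔ lcsAddP p L L 1
    | i + 2 => lcsAddP p L L (i + 1)
  have := length_le_finrank_of_strict_chain (C := C) (n := m + 2)
    (fun i hi => by
      match i with
      | 0 => exact lt_top_iff_ne_top.2 fun htop =>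
          (hlt 1 hm0).not_ge (lcsAddP_one_le_two_of_cyclic htop)
      | 1 =>
        refine lt_of_le_of_ne le_sup_right fun heq => hz ?_
        have : z ∈ Submodule.span ℤ_[p] {z} ⊔ lcsAddP p L L 1 :=
          Submodule.mem_sup_left (Submodule.mem_span_singleton_self z)
        rwa [← show C 2 = Submodule.span ℤ_[p] {z} ⊔ lcsAddP p L L 1 from heq] at this
      | i + 2 => exact hlt (i + 1) (by omega))
    (fun i _ y => by
      match i with
      | 0 => exact Submodule.mem_top
      | 1 => exact Submodule.mem_sup_right (smul_mem_lcsAddP 1 y)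
      | i + 2 => exact smul_mem_lcsAddP (i + 1) y)
  omega
end

/-! ### Saturable lattices from weighted lower central series -/

section
variable {p : ℕ} [Fact p.Prime] {L : Type*} [LieRing L] [LieAlgebra ℤ_[p] L]

theorem lie_mem_lowerCentralSeries {R L : Type*} [CommRing R] [LieRing L] [LieAlgebra R L]
    (a b : ℕ) : ∀ {x y : L}, x ∈ lowerCentralSeries R L L a → y ∈ lowerCentralSeries R L L b →
      ⁅x, y⁆ ∈ lowerCentralSeries R L L (a + b + 1) := by
  have hstep : ∀ (k : ℕ) (u v : L), v ∈ lowerCentralSeries R L L k →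
      ⁅u, v⁆ ∈ lowerCentralSeries R L L (k + 1) := fun k u v hv => by
    rw [lowerCentralSeries_succ]
    exact LieSubmodule.lie_mem_lie (LieSubmodule.mem_top u) hv
  induction a generalizing b with
  | zero => intro x y _ hy; rw [zero_add]; exact hstep b x y hy
  | succ a ih =>
    intro x y hx hy
    rw [lowerCentralSeries_succ, ← LieSubmodule.mem_toSubmodule,
      LieSubmodule.lieIdeal_oper_eq_linear_span'] at hx
    induction hx using Submodule.span_induction with
    | mem x hx =>
      obtain ⟨u, -, v, hv, rfl⟩ := hx
      rw [lie_lie]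
      refine sub_mem ?_ ?_
      · have := hstep _ u _ (ih b hv hy)
        rwa [show a + b + 1 + 1 = a + 1 + b + 1 by ring] at this
      · have := ih (b + 1) hv (hstep b u y hy)
        rwa [show a + (b + 1) + 1 = a + 1 + b + 1 by ring] at this
    | zero => rw [zero_lie]; exact zero_mem _
    | add u v _ _ hu hv => rw [add_lie]; exact add_mem hu hv
    | smul c u _ hu => rw [smul_lie]; exact Submodule.smul_mem _ c hu

/-- A filtration `F` of `L` with `⁅F m, F n⁆ ≤ F (m + n + 1)` and `F (n + q) = p F n` makes `L`
saturable: giving weight `(n + 1) / q` to the elements of `F n` outside `F (n + 1)` defines a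
saturated valuation. All weights are at least `1 / q`, and the elements of weight larger than `1`
form `F q = p L`. -/
theorem isSaturable_of_filtration [Module.Free ℤ_[p] L] [Module.Finite ℤ_[p] L] {q : ℕ}
    (hq : 1 ≤ q) (hqp : q + 2 ≤ p) {F : ℕ → Submodule ℤ_[p] L} (hF : Antitone F)
    (hF0 : F 0 = ⊤) (hsmul : ∀ n x, (p : ℤ_[p]) • x ∈ F (n + q) ↔ x ∈ F n)
    (hdiv : ∀ n, ∀ x ∈ F (n + q), ∃ y, (p : ℤ_[p]) • y = x)
    (hlie : ∀ m n x y, x ∈ F m → y ∈ F n → ⁅x, y⁆ ∈ F (m + n + 1)) :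
    IsSaturable p L := by
  have hp0 : (p : ℤ_[p]) ≠ 0 := PadicInt.prime_p.ne_zero
  have hbot : ∀ x : L, x ≠ 0 → ∃ n, x ∉ F n := by
    intro x hx
    by_contra! hall
    have hpow : ∀ k : ℕ, ∃ y : L, (∀ n, y ∈ F n) ∧ (p : ℤ_[p]) ^ k • y = x := by
      intro k
      induction k with
      | zero => exact ⟨x, hall, by simp⟩
      | succ k ih =>
        obtain ⟨y, hy, hyx⟩ := ih
        obtain ⟨z, rfl⟩ := hdiv 0 y (hy _)
        exact ⟨z, fun n => (hsmul n z).1 (hy _), by rw [pow_succ, mul_smul, hyx]⟩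
    let b := Module.Free.chooseBasis ℤ_[p] L
    refine hx (b.ext_elem_iff.2 fun i => ?_)
    rw [map_zero, Finsupp.coe_zero, Pi.zero_apply]
    by_contra hne
    obtain ⟨y, -, hy⟩ := hpow ((b.repr x i).valuation + 1)
    have h1 : b.repr x i = (p : ℤ_[p]) ^ ((b.repr x i).valuation + 1) * b.repr y i := by
      conv_lhs => rw [← hy]
      simp
    have h2 : (b.repr x i).valuation + 1 ≤ (b.repr x i).valuation :=
      (PadicInt.mem_span_pow_iff_le_valuation _ hne _).1
        (Ideal.mem_span_singleton.2 ⟨_, h1⟩)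
    omega
  -- `d x` is the first index `n` with `x ∉ F n`; its value at `0` is irrelevant.
  have hex : ∀ x : L, ∃ d : ℕ, x ≠ 0 → ∀ n, x ∈ F n ↔ n < d := by
    classical
    intro x
    by_cases hx : x = 0
    · exact ⟨0, fun h => absurd hx h⟩
    · refine ⟨Nat.find (hbot x hx), fun _ n => ⟨fun h => ?_, fun h => ?_⟩⟩
      · by_contra! hle
        exact Nat.find_spec (hbot x hx) (hF hle h)
      · by_contra hn
        exact Nat.find_min (hbot x hx) h hn
  choose d hd using hex
  have hd1 : ∀ x, x ≠ 0 → 1 ≤ d x := fun x hx => (hd x hx 0).1 (by simp [hF0])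
  have hdp : ∀ x, x ≠ 0 → d ((p : ℤ_[p]) • x) = q + d x := by
    intro x hx
    have hpx : (p : ℤ_[p]) • x ≠ 0 := smul_ne_zero hp0 hx
    refine eq_of_forall_lt_iff fun n => ?_
    rw [← hd _ hpx]
    rcases le_total q n with h | h
    · obtain ⟨m, rfl⟩ := Nat.exists_eq_add_of_le' h
      rw [hsmul, hd x hx]
      omega
    · have : (p : ℤ_[p]) • x ∈ F (0 + q) := (hsmul 0 x).2 (by simp [hF0])
      have h1 := hd1 x hx
      exact ⟨fun _ => by omega, fun _ => hF (by omega) this⟩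
  have hdpow : ∀ (k : ℕ) x, x ≠ 0 → d ((p : ℤ_[p]) ^ k • x) = k * q + d x := by
    intro k
    induction k with
    | zero => simp
    | succ k ih =>
      intro x hx
      rw [pow_succ, mul_smul, ih _ (smul_ne_zero hp0 hx), hdp x hx]
      ring
  have hds : ∀ (c : ℤ_[p]) x, c ≠ 0 → x ≠ 0 → d (c • x) = c.valuation * q + d x := by
    intro c x hc hx
    rw [← hdpow _ x hx]
    have hpx : (p : ℤ_[p]) ^ c.valuation • x ≠ 0 := smul_ne_zero (pow_ne_zero _ hp0) hx
    refine eq_of_forall_lt_iff fun n => ?_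
    rw [← hd _ (smul_ne_zero hc hx), ← hd _ hpx]
    conv_lhs => rw [PadicInt.unitCoeff_spec hc, mul_smul]
    exact Submodule.smul_mem_iff_of_isUnit _ (Units.isUnit _)
  have hq0 : (0 : ℝ) < q := by exact_mod_cast hq
  have hqp' : (q : ℝ) + 2 ≤ p := by exact_mod_cast hqp
  classical
  let w : L → WithTop ℝ := fun x => if x = 0 then ⊤ else (((d x : ℝ) / q : ℝ) : WithTop ℝ)
  have hw0 : w 0 = ⊤ := if_pos rfl
  have hw : ∀ x, x ≠ 0 → w x = (((d x : ℝ) / q : ℝ) : WithTop ℝ) := fun x hx => if_neg hx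
  refine ⟨w, ⟨⟨fun x => ?_, fun x => ?_, fun x y => ?_, fun c x hc => ?_, fun x y => ?_⟩,
    fun x h => ?_⟩⟩
  · by_cases hx : x = 0
    · simp [hx, hw0]
    · simp [hw x hx, hx]
  · by_cases hx : x = 0
    · rw [hx, hw0]; exact WithTop.coe_lt_top _
    · rw [hw x hx, WithTop.coe_lt_coe]
      have h1 : (1 : ℝ) ≤ d x := by exact_mod_cast hd1 x hx
      exact div_lt_div_of_pos_left one_pos hq0 (by linarith) |>.trans_le (by gcongr)
  · by_cases hx : x = 0
    · by_cases hy : y = 0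
      · simp [hx, hy]
      · have : d (0 - y) = d y := by
          rw [zero_sub]
          refine eq_of_forall_lt_iff fun n => ?_
          rw [← hd _ (neg_ne_zero.2 hy), ← hd _ hy, neg_mem_iff]
        rw [hx, hw0, hw y hy, hw _ (by simpa using hy), this]
        simp
    by_cases hy : y = 0
    · simp [hy]
    by_cases hxy : x - y = 0
    · rw [hxy, hw0]; exact le_top
    rw [hw x hx, hw y hy, hw _ hxy]
    have h1x := hd1 x hx
    have h1y := hd1 y hy
    have : min (d x) (d y) ≤ d (x - y) := by
      have h1 : x ∈ F (min (d x) (d y) - 1) := (hd x hx _).2 (by omega)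
      have h2 : y ∈ F (min (d x) (d y) - 1) := (hd y hy _).2 (by omega)
      have := (hd _ hxy _).1 (sub_mem h1 h2)
      omega
    rcases min_le_iff.1 this with h | h
    · refine (min_le_left _ _).trans ?_
      rw [WithTop.coe_le_coe]; gcongr
    · refine (min_le_right _ _).trans ?_
      rw [WithTop.coe_le_coe]; gcongr
  · by_cases hx : x = 0
    · simp [hx, hw0]
    · rw [hw x hx, hw _ (smul_ne_zero hc hx), ← WithTop.coe_add, WithTop.coe_inj, hds c x hc hx]
      push_cast
      field_simp
  · by_cases hxy : ⁅x, y⁆ = 0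
    · rw [hxy, hw0]; exact le_top
    have hx : x ≠ 0 := fun h => hxy (by rw [h, zero_lie])
    have hy : y ≠ 0 := fun h => hxy (by rw [h, lie_zero])
    rw [hw x hx, hw y hy, hw _ hxy, ← WithTop.coe_add, WithTop.coe_le_coe, ← add_div]
    have h1x := hd1 x hx
    have h1y := hd1 y hy
    have h1 : x ∈ F (d x - 1) := (hd x hx _).2 (by omega)
    have h2 : y ∈ F (d y - 1) := (hd y hy _).2 (by omega)
    have h3 := (hd _ hxy _).1 (hlie _ _ _ _ h1 h2)
    have h4 : d x + d y ≤ d ⁅x, y⁆ := by omega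
    gcongr
    exact_mod_cast h4
  · by_cases hx : x = 0
    · exact ⟨0, by simp [hx]⟩
    rw [hw x hx, WithTop.coe_lt_coe] at h
    refine hdiv 0 x ((hd x hx _).2 ?_)
    have h1 : (1 : ℝ) < p / (p - 1) := by
      rw [lt_div_iff₀] <;> linarith
    have h2 := h1.trans h
    rw [one_lt_div hq0] at h2
    rw [zero_add]
    exact_mod_cast h2

/-- The filtration of `L` whose `n`-th term is spanned by all `p ^ j • lowerCentralSeries k` with
`n ≤ j * q + k`. Its indices start at `0` and are one less than the weights, so that a bracket of
terms `m` and `n` lies in term `m + n + 1`. -/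
noncomputable def weightedLCS (p : ℕ) [Fact p.Prime] (L : Type*) [LieRing L] [LieAlgebra ℤ_[p] L]
    (q n : ℕ) : Submodule ℤ_[p] L :=
  Submodule.span ℤ_[p] {x | ∃ j k : ℕ, n ≤ j * q + k ∧
    ∃ y ∈ lowerCentralSeries ℤ_[p] L L k, (p : ℤ_[p]) ^ j • y = x}

/-- If the `q`-th term of the lower central series lies in `p L` for some `q ≤ p - 2`, then `L` is
saturable, by way of `weightedLCS`. -/
theorem isSaturable_of_lcs_le [Module.Free ℤ_[p] L] [Module.Finite ℤ_[p] L] {q : ℕ}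
    (hq : 1 ≤ q) (hqp : q + 2 ≤ p)
    (h : ∀ x ∈ lowerCentralSeries ℤ_[p] L L q, ∃ y : L, (p : ℤ_[p]) • y = x) :
    IsSaturable p L := by
  have hp0 : (p : ℤ_[p]) ≠ 0 := PadicInt.prime_p.ne_zero
  have hlcs : ∀ n, ∀ x ∈ lowerCentralSeries ℤ_[p] L L (n + q),
      ∃ y ∈ lowerCentralSeries ℤ_[p] L L n, (p : ℤ_[p]) • y = x := by
    intro n
    induction n with
    | zero =>
      intro x hx
      obtain ⟨y, hy⟩ := h x (by rwa [zero_add] at hx)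
      exact ⟨y, by simp, hy⟩
    | succ n ih =>
      intro x hx
      rw [Nat.add_right_comm, lowerCentralSeries_succ, ← LieSubmodule.mem_toSubmodule,
        LieSubmodule.lieIdeal_oper_eq_linear_span'] at hx
      induction hx using Submodule.span_induction with
      | mem x hx =>
        obtain ⟨u, -, v, hv, rfl⟩ := hx
        obtain ⟨y, hy, rfl⟩ := ih v hv
        refine ⟨⁅u, y⁆, ?_, by simp⟩
        rw [lowerCentralSeries_succ]
        exact LieSubmodule.lie_mem_lie (LieSubmodule.mem_top u) hy
      | zero => exact ⟨0, zero_mem _, by simp⟩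
      | add u v _ _ hu hv =>
        obtain ⟨a, ha, rfl⟩ := hu
        obtain ⟨b, hb, rfl⟩ := hv
        exact ⟨a + b, add_mem ha hb, smul_add _ _ _⟩
      | smul c u _ hu =>
        obtain ⟨a, ha, rfl⟩ := hu
        exact ⟨c • a, Submodule.smul_mem _ c ha, smul_comm _ _ _⟩
  have hdiv : ∀ n, ∀ x ∈ weightedLCS p L q (n + q), ∃ y ∈ weightedLCS p L q n,
      (p : ℤ_[p]) • y = x := by
    intro n x hx
    induction hx using Submodule.span_induction with
    | mem x hx =>
      obtain ⟨j, k, hjk, y, hy, rfl⟩ := hx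
      rcases j with _ | j
      · obtain ⟨z, hz, rfl⟩ := hlcs n y (antitone_lowerCentralSeries ℤ_[p] L L (by omega) hy)
        exact ⟨z, Submodule.subset_span ⟨0, n, by omega, z, hz, by simp⟩, by simp⟩
      · refine ⟨(p : ℤ_[p]) ^ j • y, Submodule.subset_span ⟨j, k, ?_, y, hy, rfl⟩, ?_⟩
        · rw [Nat.succ_mul] at hjk; omega
        · rw [smul_smul, pow_succ']
    | zero => exact ⟨0, zero_mem _, by simp⟩
    | add u v _ _ hu hv =>
      obtain ⟨a, ha, rfl⟩ := hu
      obtain ⟨b, hb, rfl⟩ := hv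
      exact ⟨a + b, add_mem ha hb, smul_add _ _ _⟩
    | smul c u _ hu =>
      obtain ⟨a, ha, rfl⟩ := hu
      exact ⟨c • a, Submodule.smul_mem _ c ha, smul_comm _ _ _⟩
  refine isSaturable_of_filtration hq hqp (F := weightedLCS p L q) ?_ ?_ ?_ ?_ ?_
  · intro m n hmn
    refine Submodule.span_mono ?_
    rintro x ⟨j, k, hjk, hx⟩
    exact ⟨j, k, hmn.trans hjk, hx⟩
  · exact eq_top_iff.2 fun x _ => Submodule.subset_span ⟨0, 0, by simp, x, by simp, by simp⟩
  · intro n x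
    constructor
    · intro hx
      obtain ⟨y, hy, hyx⟩ := hdiv n _ hx
      rwa [← smul_right_injective L hp0 hyx]
    · intro hx
      induction hx using Submodule.span_induction with
      | mem x hx =>
        obtain ⟨j, k, hjk, y, hy, rfl⟩ := hx
        refine Submodule.subset_span ⟨j + 1, k, ?_, y, hy, ?_⟩
        · rw [Nat.succ_mul]; omega
        · rw [smul_smul, pow_succ']
      | zero => rw [smul_zero]; exact zero_mem _
      | add u v _ _ hu hv => rw [smul_add]; exact add_mem hu hv
      | smul c u _ hu => rw [smul_comm]; exact Submodule.smul_mem _ c hu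
  · intro n x hx
    obtain ⟨y, -, hy⟩ := hdiv n x hx
    exact ⟨y, hy⟩
  · intro m n x y hx hy
    induction hx using Submodule.span_induction with
    | mem x hx =>
      obtain ⟨j, k, hjk, u, hu, rfl⟩ := hx
      induction hy using Submodule.span_induction with
      | mem y hy =>
        obtain ⟨j', k', hjk', v, hv, rfl⟩ := hy
        refine Submodule.subset_span ⟨j + j', k + k' + 1, ?_, ⁅u, v⁆,
          lie_mem_lowerCentralSeries k k' hu hv, ?_⟩
        · rw [add_mul]; omega
        · rw [smul_lie, lie_smul, smul_smul, pow_add]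
      | zero => rw [lie_zero]; exact zero_mem _
      | add u v _ _ hu hv => rw [lie_add]; exact add_mem hu hv
      | smul c u _ hu => rw [lie_smul]; exact Submodule.smul_mem _ c hu
    | zero => rw [zero_lie]; exact zero_mem _
    | add u v _ _ hu hv => rw [add_lie]; exact add_mem hu hv
    | smul c u _ hu => rw [smul_lie]; exact Submodule.smul_mem _ c hu
end

/-! ### Potent filtrations in lattices with a valuation -/

section
variable {p : ℕ} [Fact p.Prime] {L : Type*} [LieRing L] [LieAlgebra ℤ_[p] L]

theorem one_div_sub_one_pos (p : ℕ) [hp : Fact p.Prime] : (0 : ℝ) < 1 / ((p : ℝ) - 1) := by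
  have : (1 : ℝ) < p := by exact_mod_cast hp.out.one_lt
  exact one_div_pos.2 (by linarith)

namespace IsLieValuation
variable {w : L → WithTop ℝ} (hw : IsLieValuation p L w)
include hw

theorem zero_eq_top : w 0 = ⊤ := (hw.eq_top_iff 0).2 rfl

theorem nonneg (x : L) : 0 ≤ w x :=
  (WithTop.coe_le_coe.2 (one_div_sub_one_pos p).le).trans (hw.gt x).le

theorem le_neg (x : L) : w x ≤ w (-x) := by
  simpa [hw.zero_eq_top] using hw.min_le_sub 0 x

theorem min_le_add (x y : L) : min (w x) (w y) ≤ w (x + y) := by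
  have := hw.min_le_sub x (-y)
  rw [sub_neg_eq_add] at this
  exact (min_le_min_left _ (hw.le_neg y)).trans this

theorem le_smul (c : ℤ_[p]) (x : L) : w x ≤ w (c • x) := by
  by_cases hc : c = 0
  · rw [hc, zero_smul, hw.zero_eq_top]; exact le_top
  · rw [hw.smul c x hc]
    refine le_add_of_nonneg_left ?_
    exact WithTop.coe_le_coe.2 (Nat.cast_nonneg _)

/-- The Lie ideal of the elements of value at least `r`. -/
def level (r : ℝ) : LieIdeal ℤ_[p] L where
  carrier := {x | (r : WithTop ℝ) ≤ w x}
  add_mem' {x y} hx hy := (le_min hx hy).trans (hw.min_le_add x y)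
  zero_mem' := by
    change _ ≤ w 0
    rw [hw.zero_eq_top]; exact le_top
  smul_mem' c x hx := le_trans hx (hw.le_smul c x)
  lie_mem {x m} hm := le_trans (le_trans hm (le_add_of_nonneg_left (hw.nonneg x)))
    (hw.add_le_lie x m)

theorem mem_level {r : ℝ} {x : L} : x ∈ hw.level r ↔ (r : WithTop ℝ) ≤ w x := Iff.rfl

/-- On a lattice the strict bound `1 / (p - 1) < w x` is uniform in `x`. -/
theorem exists_level_eq_top [Module.Finite ℤ_[p] L] :
    ∃ c : ℝ, 1 / ((p : ℝ) - 1) < c ∧ hw.level c = ⊤ := by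
  have hfin : ∀ s : Finset L, ∃ c : ℝ, 1 / ((p : ℝ) - 1) < c ∧ ∀ x ∈ s, x ∈ hw.level c := by
    classical
    intro s
    induction s using Finset.induction_on with
    | empty => exact ⟨_, lt_add_one _, by simp⟩
    | insert a s _ ih =>
      obtain ⟨c, hc, hs⟩ := ih
      obtain ⟨r, hr, har⟩ : ∃ r : ℝ, 1 / ((p : ℝ) - 1) < r ∧ (r : WithTop ℝ) ≤ w a := by
        have hgt := hw.gt a
        rcases h : w a with _ | r
        · exact ⟨_, lt_add_one _, le_top⟩
        · rw [h] at hgt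
          exact ⟨r, WithTop.coe_lt_coe.1 hgt, le_rfl⟩
      refine ⟨min c r, lt_min hc hr, fun x hx => ?_⟩
      rcases Finset.mem_insert.1 hx with rfl | hx
      · exact (WithTop.coe_le_coe.2 (min_le_right c r)).trans har
      · exact (WithTop.coe_le_coe.2 (min_le_left c r)).trans (hs x hx)
  obtain ⟨s, hs⟩ := Module.Finite.fg_top (R := ℤ_[p]) (M := L)
  obtain ⟨c, hc, hsc⟩ := hfin s
  refine ⟨c, hc, ?_⟩
  have hle : Submodule.span ℤ_[p] (s : Set L) ≤ (hw.level c : Submodule ℤ_[p] L) :=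
    Submodule.span_le.2 hsc
  rw [hs] at hle
  exact _root_.eq_top_iff.2 fun x _ => hle (Submodule.mem_top (x := x))

theorem eq_zero_of_forall_mem_level {x : L} {r : ℕ → ℝ}
    (hr : Filter.Tendsto r Filter.atTop Filter.atTop) (hx : ∀ i, x ∈ hw.level (r i)) : x = 0 := by
  rw [← hw.eq_top_iff]
  by_contra hne
  obtain ⟨s, hs⟩ := WithTop.ne_top_iff_exists.1 hne
  obtain ⟨i, hi⟩ := (hr.eventually_gt_atTop s).exists
  have := hx i
  rw [mem_level, ← hs, WithTop.coe_le_coe] at this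
  linarith

theorem lie_top_le_level {c r : ℝ} (hc : hw.level c = ⊤) {N : LieIdeal ℤ_[p] L}
    (hN : N ≤ hw.level r) : ⁅(⊤ : LieIdeal ℤ_[p] L), N⁆ ≤ hw.level (r + c) := by
  rw [LieSubmodule.lie_le_iff]
  intro x _ m hm
  have hx : x ∈ hw.level c := hc ▸ LieSubmodule.mem_top x
  rw [mem_level, add_comm, WithTop.coe_add]
  exact (add_le_add hx (hN hm)).trans (hw.add_le_lie x m)

theorem lcs_le_level {c r : ℝ} (hc : hw.level c = ⊤) {N : LieIdeal ℤ_[p] L}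
    (hN : N ≤ hw.level r) (k : ℕ) : LieSubmodule.lcs k N ≤ hw.level (r + k * c) := by
  induction k with
  | zero => simpa using hN
  | succ k ih =>
    rw [LieSubmodule.lcs_succ, show r + ((k + 1 : ℕ) : ℝ) * c = r + k * c + c by push_cast; ring]
    exact hw.lie_top_le_level hc ih

theorem mem_level_of_smul_mem {r : ℝ} {x : L} (h : (p : ℤ_[p]) • x ∈ hw.level (r + 1)) :
    x ∈ hw.level r := by
  rw [mem_level, hw.smul _ _ PadicInt.prime_p.ne_zero, PadicInt.valuation_p, add_comm r,
    WithTop.coe_add, Nat.cast_one] at h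
  exact (WithTop.add_le_add_iff_left WithTop.coe_ne_top).1 h

/-- `L` acts nilpotently on `N / p N`, as bracketing with `L` raises `w` by a fixed positive
amount; hence `p - 1` brackets take an ideal `N` of dimension less than `p` into `p N`. -/
theorem lcs_le_smul_of_finrank_lt [Module.Free ℤ_[p] L] [Module.Finite ℤ_[p] L]
    {N : LieIdeal ℤ_[p] L} (hN : Module.finrank ℤ_[p] N < p) :
    ∀ x ∈ LieSubmodule.lcs (p - 1) N, ∃ y ∈ N, (p : ℤ_[p]) • y = x := by
  obtain ⟨c, hc, hctop⟩ := hw.exists_level_eq_top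
  have hc0 : 0 < c := (one_div_sub_one_pos p).trans hc
  have : Module.Free ℤ_[p] N := inferInstanceAs (Module.Free ℤ_[p] (N : Submodule ℤ_[p] L))
  have : Module.Finite ℤ_[p] N := inferInstanceAs (Module.Finite ℤ_[p] (N : Submodule ℤ_[p] L))
  have hinf : ⨅ k, lowerCentralSeries ℤ_[p] L N k = ⊥ := by
    rw [LieSubmodule.eq_bot_iff]
    intro x hx
    rw [LieSubmodule.mem_iInf] at hx
    refine Subtype.ext (hw.eq_zero_of_forall_mem_level (r := fun k => 0 + k * c) ?_ fun k =>
      hw.lcs_le_level hctop (fun y _ => hw.nonneg y) k (N := N) ?_)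
    · simpa using tendsto_natCast_atTop_atTop.atTop_mul_const hc0
    · have := hx k
      rw [LieSubmodule.lowerCentralSeries_eq_lcs_comap] at this
      simpa using this
  intro x hx
  rw [← LieSubmodule.lowerCentralSeries_map_eq_lcs, LieSubmodule.mem_map] at hx
  obtain ⟨z, hz, rfl⟩ := hx
  obtain ⟨y, rfl⟩ := lcs_le_smul_of_finrank_le hinf (m := p - 1) (by omega) z hz
  exact ⟨y, y.2, rfl⟩

end IsLieValuation

/-- The Lie submodule `{m | c m ∈ N}`; it is `c⁻¹ N` where `c` is invertible. -/
def LieSubmodule.smulComap {R L M : Type*} [CommRing R] [LieRing L] [LieAlgebra R L]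
    [AddCommGroup M] [Module R M] [LieRingModule L M] [LieModule R L M] (c : R)
    (N : LieSubmodule R L M) : LieSubmodule R L M where
  toSubmodule := Submodule.comap (LinearMap.lsmul R M c) N
  lie_mem {x m} hm := by
    change c • ⁅x, m⁆ ∈ N
    rw [← lie_smul]
    exact N.lie_mem hm

/-- `[N, L] + p⁻¹ [N, L, …, L]` with `p - 1` factors `L`: the least candidate for the term after `N`
in a potent filtration. -/
noncomputable def potentStep (p : ℕ) [Fact p.Prime] {L : Type*} [LieRing L] [LieAlgebra ℤ_[p] L]
    (N : LieIdeal ℤ_[p] L) : LieIdeal ℤ_[p] L :=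
  ⁅(⊤ : LieIdeal ℤ_[p] L), N⁆ ⊔ (LieSubmodule.lcs (p - 1) N).smulComap (p : ℤ_[p])

/-- A lattice with a Lie valuation has all its ideals of dimension less than `p` PF-embedded:
iterating `potentStep` stays inside `M`, and each iteration raises `w` by a fixed positive
amount. -/
theorem IsLieValuation.isPFEmbedded [Module.Free ℤ_[p] L] [Module.Finite ℤ_[p] L]
    {w : L → WithTop ℝ} (hw : IsLieValuation p L w) {M : LieIdeal ℤ_[p] L}
    (hM : Module.finrank ℤ_[p] M < p) : IsPFEmbedded p M := by
  obtain ⟨c, hc, hctop⟩ := hw.exists_level_eq_top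
  have hp1 : (1 : ℝ) < p := by exact_mod_cast (Fact.out : p.Prime).one_lt
  have hc0 : 0 < c := (one_div_sub_one_pos p).trans hc
  have hc1 : 0 < ((p - 1 : ℕ) : ℝ) * c - 1 := by
    rw [Nat.cast_sub (Fact.out : p.Prime).one_lt.le, Nat.cast_one]
    rw [div_lt_iff₀ (by linarith)] at hc
    linarith
  let N : ℕ → LieIdeal ℤ_[p] L := fun i => (potentStep p)^[i] M
  have hNs : ∀ i, N (i + 1) = potentStep p (N i) := fun i => Function.iterate_succ_apply' _ _ _
  have hdim : ∀ K : LieIdeal ℤ_[p] L, K ≤ M →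
      ∀ x ∈ LieSubmodule.lcs (p - 1) K, ∃ y ∈ K, (p : ℤ_[p]) • y = x := fun K hK =>
    hw.lcs_le_smul_of_finrank_lt (lt_of_le_of_lt
      (Submodule.finrank_mono (s := (K : Submodule ℤ_[p] L)) (t := M) hK) hM)
  have hstep : ∀ K : LieIdeal ℤ_[p] L, K ≤ M → potentStep p K ≤ K := by
    intro K hK
    refine sup_le (LieSubmodule.lie_le_right _ _) fun y hy => ?_
    obtain ⟨z, hz, hzy⟩ := hdim K hK _ hy
    rwa [← smul_right_injective L (PadicInt.prime_p (p := p)).ne_zero hzy]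
  have hNM : ∀ i, N i ≤ M := by
    intro i
    induction i with
    | zero => exact le_rfl
    | succ i ih => rw [hNs]; exact (hstep _ ih).trans ih
  -- `[N, L]` gains `c`, while `p⁻¹ [N, L, …, L]` gains `(p - 1) c` and loses `1`.
  let δ := min c (((p - 1 : ℕ) : ℝ) * c - 1)
  have hδ : 0 < δ := lt_min hc0 hc1
  have hlevel_anti : ∀ {r s : ℝ}, r ≤ s → hw.level s ≤ hw.level r := fun hrs x hx =>
    (WithTop.coe_le_coe.2 hrs).trans hx
  have hlev : ∀ i : ℕ, N i ≤ hw.level (i * δ) := by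
    intro i
    induction i with
    | zero => exact fun x _ => by simpa [hw.mem_level] using hw.nonneg x
    | succ i ih =>
      rw [hNs, show ((i + 1 : ℕ) : ℝ) * δ = i * δ + δ by push_cast; ring]
      refine sup_le ((hw.lie_top_le_level hctop ih).trans (hlevel_anti ?_)) fun y hy => ?_
      · have := min_le_left c (((p - 1 : ℕ) : ℝ) * c - 1)
        linarith
      · refine hw.mem_level_of_smul_mem
          (hlevel_anti ?_ (hw.lcs_le_level hctop ih (p - 1) hy))
        have := min_le_right c (((p - 1 : ℕ) : ℝ) * c - 1)
        linarith
  refine ⟨N, antitone_nat_of_succ_le fun i => (hNs i).trans_le (hstep _ (hNM i)), rfl, ?_,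
    fun i => (hNs i).symm ▸ le_sup_left, fun i x hx => ?_⟩
  · rw [LieSubmodule.eq_bot_iff]
    intro x hx
    rw [LieSubmodule.mem_iInf] at hx
    exact hw.eq_zero_of_forall_mem_level (tendsto_natCast_atTop_atTop.atTop_mul_const hδ)
      fun i => hlev i (hx i)
  · obtain ⟨y, -, rfl⟩ := hdim _ (hNM i) x hx
    refine ⟨y, ?_, rfl⟩
    rw [hNs]
    exact (le_sup_right : (LieSubmodule.lcs (p - 1) (N i)).smulComap (p : ℤ_[p]) ≤ _) hx
end

theorem mainTheorem8 (p : ℕ) [Fact p.Prime] (hp : p ≠ 2)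
    (L : Type*) [LieRing L] [LieAlgebra ℤ_[p] L] [IsLieLattice p L] :
    (IsResiduallyNilpotent p L → Module.finrank ℤ_[p] L < p → IsSaturable p L) ∧
    (IsSaturable p L →
      ∀ M : LieIdeal ℤ_[p] L, Module.finrank ℤ_[p] M < p → IsPFEmbedded p M) := by
  have : Module.Free ℤ_[p] L := IsLieLattice.free
  have : Module.Finite ℤ_[p] L := IsLieLattice.finite
  refine ⟨fun hres hdim => ?_, fun ⟨w, hw⟩ M hM => hw.toIsLieValuation.isPFEmbedded hM⟩
  have h2 := (Fact.out : p.Prime).two_le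
  exact isSaturable_of_lcs_le (q := p - 2) (by omega) (by omega)
    (lcs_le_smul_of_finrank_le_succ hres (by omega) (by omega))
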